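/- Let $\mathcal X$ be a finite set and let $W_0,W_1$ be irreducible and ergodic (i.e. irreducible and aperiodic) transition matrices on $\mathcal X$ with the same support, $W_0(x|\bar x)=0\iff W_1(x|\bar x)=0$, where $W_i(x|\bar x)$ is the probability of moving from $\bar x$ to $x$. Let $P_0,P_1$ be probability distributions on $\mathcal X$ such that $P_1(x)=0$ whenever $P_0(x)=0$. Let $$W_i^{\times n}\times P_i(x_{n+1},\dots,x_1):=W_i(x_{n+1}|x_n)\cdots W_i(x_2|x_1)P_i(x_1)$$ be the law of the first $n+1$ states of the Markov chain. For distributions $Q_1,Q_0$ on a finite set and $\epsilon\in(0,1)$ put $$\beta_\epsilon(Q_1\|Q_0):=\min_T\{\mathsf E_{Q_0}[1-T]\;:\;0\le T\le 1,\ \mathsf E_{Q_1}[T]\le\epsilon\}.$$ Let $\phi(\theta)$ be the logarithm of the Perron–Frobenius eigenvalue (spectral radius) of the matrix $W_0(x|\bar x)e^{\theta g(x,\bar x)}$ with $g(x,\bar x)=\log\frac{W_1(x|\bar x)}{W_0(x|\bar x)}$ on the common support. Let $\varphi(t)$ be the logarithm of the Perron–Frobenius eigenvalue of $W_1(x|\bar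 x)^{t}\,W_0(x|\bar x)^{1-t}$ (zero off the support), and let $D(W_1\|W_0):=\varphi'(1)$. Let $\Phi^{-1}$ be the inverse of the standard normal distribution function $\Phi(y)=\int_{-\infty}^y\frac{e^{-x^2/2}}{\sqrt{2\pi}}\,dx$. Then $\varphi$ is differentiable at $1$, $\phi$ is twice continuously differentiable near $1$ with $\phi''(1)\ge 0$, and for every fixed $\epsilon\in(0,1)$, as $n\to\infty$, $$-\log\beta_\epsilon(W_1^{\times n}\times P_1\,\|\,W_0^{\times n}\times P_0)= n\,D(W_1\|W_0)+\sqrt n\,\sqrt{\phi''(1)}\;\Phi^{-1}(\epsilon)+o(\sqrt n).$$ The same expansion holds if, in the definition of $\beta_\epsilon$, the minimum is taken only over deterministic tests $T=1_S$, $S\subset\mathcal X^{n+1}$. -/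

import Mathlib

open Matrix Filter Topology Asymptotics ProbabilityTheory

/-- A transition matrix on a finite set, in the convention `W x y = W(x|y)` (the probability of
moving from `y` to `x`): the entries are non-negative and every column sums to `1`. -/
def IsTransitionMatrix {X : Type*} [Fintype X] [DecidableEq X] (W : Matrix X X ℝ) : Prop :=
  W ∈ colStochastic ℝ X

/-- An ergodic matrix: irreducible, and aperiodic, that is, no `x` and no integer `d ≥ 2` satisfy
`W ^ n x x = 0` for all `n` that are not divisible by `d`. -/
def IsErgodicMatrix {X : Type*} [Fintype X] [DecidableEq X] (W : Matrix X X ℝ) : Prop :=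
  W.IsIrreducible ∧ ∀ x : X, ∀ d : ℕ, 2 ≤ d → ∃ n : ℕ, ¬ d ∣ n ∧ (W ^ n) x x ≠ 0

/-- The law `W^{×n} × P` of the first `n + 1` states of the Markov chain with transition matrix `W`
and initial distribution `P`. The path `w` visits `w 0, w 1, …, w n` in this order. -/
def markovPathLaw {X : Type*} (W : Matrix X X ℝ) (P : X → ℝ) (n : ℕ) (w : Fin (n + 1) → X) : ℝ :=
  P (w 0) * ∏ i : Fin n, W (w i.succ) (w i.castSucc)

/-- The minimum second error probability `β_ε(P₁‖P₀)` over randomized tests `T`. -/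
noncomputable def betaError {Ω : Type*} [Fintype Ω] (ε : ℝ) (P₁ P₀ : Ω → ℝ) : ℝ :=
  sInf {b : ℝ | ∃ T : Ω → ℝ, (∀ ω, 0 ≤ T ω ∧ T ω ≤ 1) ∧ ∑ ω, P₁ ω * T ω ≤ ε ∧
    b = ∑ ω, P₀ ω * (1 - T ω)}

/-- The minimum second error probability over deterministic tests, given by their set `S`. -/
noncomputable def betaErrorDet {Ω : Type*} [Fintype Ω] (ε : ℝ) (P₁ P₀ : Ω → ℝ) : ℝ :=
  sInf {b : ℝ | ∃ S : Finset Ω, ∑ ω ∈ S, P₁ ω ≤ ε ∧ b = 1 - ∑ ω ∈ S, P₀ ω}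

/-- The Perron–Frobenius eigenvalue of a non-negative matrix: its spectral radius, the largest
modulus of its complex eigenvalues. -/
noncomputable def perronEigenvalue {X : Type*} [Fintype X] [DecidableEq X]
    (A : Matrix X X ℝ) : ℝ :=
  (spectralRadius ℂ (A.map (fun r : ℝ => (r : ℂ)))).toReal

/-- The potential `φ(θ)`: the logarithm of the Perron–Frobenius eigenvalue of the matrix
`W(x|y) e^{θ g(x,y)}`. -/
noncomputable def markovPotential {X : Type*} [Fintype X] [DecidableEq X]
    (W : Matrix X X ℝ) (g : X → X → ℝ) (θ : ℝ) : ℝ :=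
  Real.log (perronEigenvalue (Matrix.of fun x y => W x y * Real.exp (θ * g x y)))

/-- The generator `g(x,y) = log (W₁(x|y) / W₀(x|y))`. -/
noncomputable def logRatioGenerator {X : Type*} (W₁ W₀ : Matrix X X ℝ) (x y : X) : ℝ :=
  Real.log (W₁ x y / W₀ x y)

/-- The logarithm of the Perron–Frobenius eigenvalue of `W(x|y)^t V(x|y)^{1-t}`, for matrices of
the same support; the entries outside the support are `0`. -/
noncomputable def relativePotential {X : Type*} [Fintype X] [DecidableEq X]
    (W V : Matrix X X ℝ) (t : ℝ) : ℝ :=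
  Real.log (perronEigenvalue (Matrix.of fun x y => W x y ^ t * V x y ^ (1 - t)))

/-- The relative entropy `D(W‖V)` of transition matrices of the same support. -/
noncomputable def markovRelativeEntropy {X : Type*} [Fintype X] [DecidableEq X]
    (W V : Matrix X X ℝ) : ℝ :=
  deriv (relativePotential W V) 1

/-- The inverse `Φ⁻¹` (quantile function) of the standard normal distribution function. -/
noncomputable def gaussianQuantile (ε : ℝ) : ℝ :=
  sInf {y : ℝ | ε ≤ cdf (gaussianReal 0 1) y}

/-- The infimum in the definition of `betaError` is attained. -/
theorem betaError_isLeast {Ω : Type*} [Fintype Ω] {ε : ℝ} (hε : 0 ≤ ε) (P₁ P₀ : Ω → ℝ) :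
    IsLeast {b : ℝ | ∃ T : Ω → ℝ, (∀ ω, 0 ≤ T ω ∧ T ω ≤ 1) ∧ ∑ ω, P₁ ω * T ω ≤ ε ∧
      b = ∑ ω, P₀ ω * (1 - T ω)} (betaError ε P₁ P₀) := by
  have hK : IsCompact (Set.Icc (0 : Ω → ℝ) 1 ∩ {T | ∑ ω, P₁ ω * T ω ≤ ε}) :=
    isCompact_Icc.inter_right (isClosed_le (by fun_prop) continuous_const)
  have hI : IsCompact ((fun T : Ω → ℝ => ∑ ω, P₀ ω * (1 - T ω)) ''
      (Set.Icc (0 : Ω → ℝ) 1 ∩ {T | ∑ ω, P₁ ω * T ω ≤ ε})) := hK.image (by fun_prop)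
  have hE : {b : ℝ | ∃ T : Ω → ℝ, (∀ ω, 0 ≤ T ω ∧ T ω ≤ 1) ∧ ∑ ω, P₁ ω * T ω ≤ ε ∧
      b = ∑ ω, P₀ ω * (1 - T ω)} = (fun T : Ω → ℝ => ∑ ω, P₀ ω * (1 - T ω)) ''
      (Set.Icc (0 : Ω → ℝ) 1 ∩ {T | ∑ ω, P₁ ω * T ω ≤ ε}) := by
    ext b
    constructor
    · rintro ⟨T, hT, h1, rfl⟩
      exact ⟨T, ⟨⟨fun ω => (hT ω).1, fun ω => (hT ω).2⟩, h1⟩, rfl⟩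
    · rintro ⟨T, ⟨⟨h0, h1⟩, h2⟩, rfl⟩
      exact ⟨T, fun ω => ⟨h0 ω, h1 ω⟩, h2, rfl⟩
  unfold betaError
  rw [hE]
  refine hI.isLeast_sInf ⟨_, 0, ⟨⟨le_rfl, fun _ => zero_le_one⟩, ?_⟩, rfl⟩
  simpa using hε

/-!
The log-likelihood ratio of two paths is, up to the bounded contribution of the initial states, the
additive functional `pathSum g n w = ∑ᵢ g(wᵢ₊₁, wᵢ)` of the generator `g = log (W₁ / W₀)`. The proof
combines a central limit theorem for `pathSum` under `W₁` with one-shot bounds for the second error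
probability.

*Smoothness of the potential.* Tilting `W₁` by `exp (z g)` gives a matrix whose Perron eigenvalue is
`1` at `z = 0`, with the all-ones vector as a left eigenvector. The equations for a normalised left
eigenpair are non-degenerate there, by the maximum principle (`harmonic_of_isIrreducible`), so the
complex implicit function theorem continues the eigenpair analytically
(`exists_analytic_eigenpair`). For real `z` local uniqueness makes it real, and positivity of the
eigenvector identifies the eigenvalue as the spectral radius
(`perronEigenvalue_eq_of_pos_eigenvector`). Since `W₀ exp (θ g) = W₁ exp ((θ - 1) g)`, the potential
of the theorem is the one of `W₁` moved by `1`.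

*Central limit theorem.* For an eigenpair `(u z, lam z)` the transfer-matrix identity
(`sum_path_of_eigenvector`) gives `E[exp (z * pathSum) * u z (w n)] = lam z ^ n * ∑ x, P x * u z x`
exactly. At `z = i t / √n` the vector `u z` tends to `1`, and the second-order expansion of
`log (lam z)` has the real derivatives of the potential as coefficients, so the characteristic
functions converge (`tendsto_charFun_pathSum`) and Lévy's theorem applies. No spectral gap is needed.
The variance is non-negative because characteristic functions are bounded by `1`; variance zero is
not a special case, the limit law being a Dirac mass.

*One-shot bounds.* Accepting `W₀` on `{pathSum ≤ a}` has second error at most `exp (-a)`, by Markov's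
inequality under `W₀` (`betaErrorDet_le_exp`). Conversely every randomized test of level `ε` has
second error at least a constant times `exp (-a)` if the `W₁`-probability of `{pathSum ≤ a}` exceeds
`ε` by a constant (`sub_le_mul_betaError`). The thresholds
`a = n D + √n (√V Φ⁻¹(ε) ∓ δ)` satisfy the two requirements for every `δ > 0` and large `n`.
-/

/-! ### Perron roots and harmonic functions -/

/-- Maximum principle for the backward equation of an irreducible chain: a solution of
`h W = h + l` forces `l = 0`, and `h` is constant. -/
theorem harmonic_of_isIrreducible {X : Type*} [Fintype X] [DecidableEq X] [Nonempty X]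
    {W : Matrix X X ℝ} (hW : IsTransitionMatrix W) (hI : W.IsIrreducible)
    {h : X → ℝ} {l : ℝ} (hh : ∀ y, ∑ x, h x * W x y = h y + l) :
    l = 0 ∧ ∀ x y, h x = h y := by
  have hsum := (mem_colStochastic_iff_sum.1 hW).2
  obtain ⟨y₀, hy₀⟩ := Finite.exists_max h
  obtain ⟨y₁, hy₁⟩ := Finite.exists_min h
  have hle : h y₀ + l ≤ h y₀ := by
    rw [← hh y₀]
    calc ∑ x, h x * W x y₀ ≤ ∑ x, h y₀ * W x y₀ :=
          Finset.sum_le_sum fun x _ => mul_le_mul_of_nonneg_right (hy₀ x) (hW.1 x y₀)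
      _ = h y₀ := by rw [← Finset.mul_sum, hsum, mul_one]
  have hge : h y₁ ≤ h y₁ + l := by
    rw [← hh y₁]
    calc h y₁ = ∑ x, h y₁ * W x y₁ := by rw [← Finset.mul_sum, hsum, mul_one]
      _ ≤ ∑ x, h x * W x y₁ :=
          Finset.sum_le_sum fun x _ => mul_le_mul_of_nonneg_right (hy₁ x) (hW.1 x y₁)
  have hl : l = 0 := by linarith
  subst hl
  have hfix : h ᵥ* W = h := by
    ext y
    simpa [vecMul, dotProduct] using hh y
  have hpow : ∀ k : ℕ, h ᵥ* W ^ k = h := by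
    intro k
    induction k with
    | zero => simp
    | succ k ih => rw [pow_succ, ← vecMul_vecMul, ih, hfix]
  have hmax : ∀ x, h x = h y₀ := by
    intro x
    obtain ⟨k, -, hk⟩ := (isIrreducible_iff_exists_pow_pos hI.nonneg).1 hI x y₀
    have hWk : W ^ k ∈ colStochastic ℝ X := pow_mem hW k
    have hs := (mem_colStochastic_iff_sum.1 hWk).2 y₀
    have h1 : ∑ x, h x * (W ^ k) x y₀ = h y₀ := by
      simpa [vecMul, dotProduct] using congrFun (hpow k) y₀
    have h2 : ∑ x, (h y₀ - h x) * (W ^ k) x y₀ = 0 := by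
      simp only [sub_mul, Finset.sum_sub_distrib, ← Finset.mul_sum, hs, h1]
      ring
    have h3 := (Finset.sum_eq_zero_iff_of_nonneg fun x _ =>
      mul_nonneg (sub_nonneg.2 (hy₀ x)) (hWk.1 x y₀)).1 h2 x (Finset.mem_univ x)
    rcases mul_eq_zero.1 h3 with h4 | h4
    · linarith
    · exact absurd h4 hk.ne'
  exact ⟨rfl, fun x y => (hmax x).trans (hmax y).symm⟩

/-- A positive left eigenvector of a non-negative matrix belongs to the Perron–Frobenius
eigenvalue. -/
theorem perronEigenvalue_eq_of_pos_eigenvector {X : Type*} [Fintype X] [DecidableEq X] [Nonempty X]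
    {A : Matrix X X ℝ} (hA : ∀ x y, 0 ≤ A x y) {u : X → ℝ} (hu : ∀ x, 0 < u x) {l : ℝ}
    (h : ∀ y, ∑ x, u x * A x y = l * u y) : perronEigenvalue A = l := by
  obtain ⟨y₀⟩ := ‹Nonempty X›
  have hl : 0 ≤ l := by
    have h1 : 0 ≤ l * u y₀ := by
      rw [← h y₀]
      exact Finset.sum_nonneg fun x _ => mul_nonneg (hu x).le (hA x y₀)
    exact nonneg_of_mul_nonneg_left h1 (hu y₀)
  set B : Matrix X X ℂ := A.map (fun r : ℝ => (r : ℂ)) with hB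
  have hmem : (l : ℂ) ∈ spectrum ℂ B := by
    rw [spectrum.mem_iff, Matrix.isUnit_iff_isUnit_det, isUnit_iff_ne_zero, not_not]
    refine Matrix.exists_vecMul_eq_zero_iff.1 ⟨fun x => (u x : ℂ), ?_, ?_⟩
    · intro h0
      have := congrFun h0 y₀
      simp [(hu y₀).ne'] at this
    · ext y
      rw [vecMul_sub, Algebra.algebraMap_eq_smul_one, vecMul_smul, vecMul_one]
      have := congrArg (fun r : ℝ => (r : ℂ)) (h y)
      push_cast at this
      simp [vecMul, dotProduct, hB, this]
  have hle : ∀ k ∈ spectrum ℂ B, ‖k‖ ≤ l := by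
    intro k hk
    rw [spectrum.mem_iff, Matrix.isUnit_iff_isUnit_det, isUnit_iff_ne_zero, not_not] at hk
    obtain ⟨v, hv0, hv⟩ := Matrix.exists_mulVec_eq_zero_iff.2 hk
    have hv' : ∀ x, k * v x = ∑ y, (A x y : ℂ) * v y := by
      intro x
      have := congrFun hv x
      rw [sub_mulVec, Algebra.algebraMap_eq_smul_one, smul_mulVec, one_mulVec] at this
      simpa [mulVec, dotProduct, hB, sub_eq_zero] using this
    have hn : ∀ x, ‖k‖ * ‖v x‖ ≤ ∑ y, A x y * ‖v y‖ := by
      intro x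
      rw [← norm_mul, hv' x]
      refine (norm_sum_le _ _).trans (Finset.sum_le_sum fun y _ => ?_)
      rw [norm_mul, Complex.norm_real, Real.norm_of_nonneg (hA x y)]
    have hpos : 0 < ∑ x, u x * ‖v x‖ := by
      obtain ⟨x, hx⟩ := Function.ne_iff.1 hv0
      exact Finset.sum_pos' (fun x _ => mul_nonneg (hu x).le (norm_nonneg _))
        ⟨x, Finset.mem_univ x, mul_pos (hu x) (norm_pos_iff.2 hx)⟩
    refine le_of_mul_le_mul_right ?_ hpos
    calc ‖k‖ * ∑ x, u x * ‖v x‖ = ∑ x, u x * (‖k‖ * ‖v x‖) := by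
          rw [Finset.mul_sum]; exact Finset.sum_congr rfl fun x _ => by ring
      _ ≤ ∑ x, u x * ∑ y, A x y * ‖v y‖ :=
          Finset.sum_le_sum fun x _ => mul_le_mul_of_nonneg_left (hn x) (hu x).le
      _ = ∑ y, (∑ x, u x * A x y) * ‖v y‖ := by
          simp only [Finset.mul_sum, Finset.sum_mul]
          rw [Finset.sum_comm]
          exact Finset.sum_congr rfl fun x _ => Finset.sum_congr rfl fun y _ => by ring
      _ = l * ∑ x, u x * ‖v x‖ := by
          rw [Finset.mul_sum]; exact Finset.sum_congr rfl fun x _ => by rw [h]; ring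
  have hrad : spectralRadius ℂ B = ENNReal.ofReal l := by
    apply le_antisymm
    · refine iSup₂_le fun k hk => ?_
      rw [← enorm_eq_nnnorm, ← ofReal_norm]
      exact ENNReal.ofReal_le_ofReal (hle k hk)
    · refine le_trans (le_of_eq ?_) (le_iSup₂ (l : ℂ) hmem)
      rw [← enorm_eq_nnnorm, ← ofReal_norm, Complex.norm_real, Real.norm_of_nonneg hl]
  rw [perronEigenvalue, hrad, ENNReal.toReal_ofReal hl]

/-! ### Sums over paths -/

/-- The transfer-matrix identity: a sum over paths of products of matrix entries, weighted by a
left eigenvector at the end point, multiplies by the eigenvalue at each step. -/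
theorem sum_path_of_eigenvector {X R : Type*} [Fintype X] [CommRing R] (p u : X → R)
    {M : X → X → R} {l : R} (h : ∀ y, ∑ x, u x * M x y = l * u y) (n : ℕ) :
    ∑ w : Fin (n + 1) → X, (p (w 0) * ∏ i : Fin n, M (w i.succ) (w i.castSucc)) * u (w (Fin.last n))
      = l ^ n * ∑ x, p x * u x := by
  induction n with
  | zero =>
    rw [← (Equiv.funUnique (Fin 1) X).symm.sum_comp]
    simp
  | succ n ih =>
    rw [← (Fin.snocEquiv (fun _ : Fin (n + 2) => X)).sum_comp, Fintype.sum_prod_type_right,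
      pow_succ', mul_assoc, ← ih, Finset.mul_sum]
    refine Finset.sum_congr rfl fun w _ => ?_
    have h0 : ∀ x, (Fin.snoc w x : Fin (n + 2) → X) 0 = w 0 := fun x =>
      Fin.snoc_castSucc (α := fun _ => X) x w 0
    have h1 : ∀ (x) (i : Fin n), (Fin.snoc w x : Fin (n + 2) → X) i.castSucc.succ = w i.succ := by
      intro x i
      rw [Fin.succ_castSucc]
      exact Fin.snoc_castSucc (α := fun _ => X) x w i.succ
    have h2 : ∀ (x) (i : Fin (n + 1)), (Fin.snoc w x : Fin (n + 2) → X) i.castSucc = w i :=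
      fun x i => Fin.snoc_castSucc (α := fun _ => X) x w i
    have h3 : ∀ x, (Fin.snoc w x : Fin (n + 2) → X) (Fin.last (n + 1)) = x := fun x =>
      Fin.snoc_last (α := fun _ => X) x w
    simp only [Fin.snocEquiv_apply, Fin.prod_univ_castSucc (n := n), h0, h1, h2, Fin.succ_last, h3]
    rw [mul_left_comm l, ← h, Finset.mul_sum]
    exact Finset.sum_congr rfl fun x _ => by ring

/-! ### Analytic continuation of the Perron eigenvector -/

/-- The equations for a left eigenvector `u`, with eigenvalue `l`, of the tilted matrix
`W x y * exp (z * g x y)`, together with the value of `u` at `x₀`, which serves to normalise `u`. -/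
noncomputable def tiltedEigenMap {X : Type*} [Fintype X] (W : Matrix X X ℝ) (g : X → X → ℝ)
    (x₀ : X) (p : ℂ × ((X → ℂ) × ℂ)) : (X → ℂ) × ℂ :=
  (fun y => ∑ x, p.2.1 x * (W x y * Complex.exp (p.1 * g x y)) - p.2.2 * p.2.1 y, p.2.1 x₀)

theorem contDiff_tiltedEigenMap {X : Type*} [Fintype X] (W : Matrix X X ℝ) (g : X → X → ℝ)
    (x₀ : X) : ContDiff ℂ ⊤ (tiltedEigenMap W g x₀) := by
  unfold tiltedEigenMap
  refine ContDiff.prodMk (contDiff_pi.2 fun y => ?_) (by fun_prop)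
  fun_prop

theorem tiltedEigenMap_zero_one {X : Type*} [Fintype X] [DecidableEq X] {W : Matrix X X ℝ}
    (hW : IsTransitionMatrix W) (g : X → X → ℝ) (x₀ : X) :
    tiltedEigenMap W g x₀ (0, (1, 1)) = (0, 1) := by
  have hsum := (mem_colStochastic_iff_sum.1 hW).2
  refine Prod.ext (funext fun y => ?_) rfl
  have := congrArg (fun r : ℝ => (r : ℂ)) (hsum y)
  push_cast at this
  simp [tiltedEigenMap, this]

/-- The eigenvector equations are non-degenerate at the untilted chain; a vector in the kernel of
the derivative solves the equation of `harmonic_of_isIrreducible`. -/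
theorem isInvertible_fderiv_tiltedEigenMap {X : Type*} [Fintype X] [DecidableEq X]
    {W : Matrix X X ℝ} (hW : IsTransitionMatrix W) (hI : W.IsIrreducible) (g : X → X → ℝ) (x₀ : X) :
    (fderiv ℂ (tiltedEigenMap W g x₀) (0, (1, 1)) ∘L
      .inr ℂ ℂ ((X → ℂ) × ℂ)).IsInvertible := by
  have hsum := (mem_colStochastic_iff_sum.1 hW).2
  set L := fderiv ℂ (tiltedEigenMap W g x₀) (0, (1, 1)) ∘L .inr ℂ ℂ ((X → ℂ) × ℂ) with hL
  -- The derivative is computed along the lines through the base point.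
  have hLval : ∀ (h : X → ℂ) (m : ℂ), L (h, m) = (fun y => ∑ x, h x * W x y - (m + h y), h x₀) := by
    intro h m
    have hF : HasFDerivAt (tiltedEigenMap W g x₀) (fderiv ℂ (tiltedEigenMap W g x₀) (0, (1, 1)))
        ((0 : ℂ), ((1 : X → ℂ) + (0 : ℂ) • h, (1 : ℂ) + (0 : ℂ) • m)) := by
      simpa using ((contDiff_tiltedEigenMap W g x₀).differentiable (by simp)
        ((0 : ℂ), ((1 : X → ℂ), (1 : ℂ)))).hasFDerivAt
    have hc : HasDerivAt (fun t : ℂ => ((0 : ℂ), ((1 : X → ℂ) + t • h, (1 : ℂ) + t • m)))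
        (0, (h, m)) 0 := by
      refine (hasDerivAt_const _ _).prodMk (HasDerivAt.prodMk ?_ ?_)
      · simpa using ((hasDerivAt_id (0 : ℂ)).smul_const h).const_add (1 : X → ℂ)
      · simpa using ((hasDerivAt_id (0 : ℂ)).smul_const m).const_add (1 : ℂ)
    have h1 := hF.comp_hasDerivAt (0 : ℂ) hc
    have h2 : HasDerivAt (fun t : ℂ => tiltedEigenMap W g x₀
        ((0 : ℂ), ((1 : X → ℂ) + t • h, (1 : ℂ) + t • m)))
        (fun y => ∑ x, h x * W x y - (m + h y), h x₀) 0 := by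
      unfold tiltedEigenMap
      have hid : ∀ c : ℂ, HasDerivAt (fun t : ℂ => 1 + t * c) c 0 := fun c => by
        simpa using ((hasDerivAt_id (0 : ℂ)).mul_const c).const_add (1 : ℂ)
      refine HasDerivAt.prodMk (hasDerivAt_pi.2 fun y => ?_) (by simpa using hid (h x₀))
      refine HasDerivAt.sub ?_ ?_
      · simpa using HasDerivAt.fun_sum (u := Finset.univ) (x := (0 : ℂ)) fun x _ =>
          (hid (h x)).mul_const (W x y : ℂ)
      · simpa using! (hid m).fun_mul (hid (h y))
    exact h1.unique h2
  have hinj : Function.Injective L := by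
    refine (injective_iff_map_eq_zero L).2 ?_
    rintro ⟨h, m⟩ h0
    rw [hLval] at h0
    have h1 : ∀ y, ∑ x, h x * W x y = h y + m := fun y => by
      have := congrFun (congrArg Prod.fst h0) y
      simpa [sub_eq_zero, add_comm] using this
    have h2 : h x₀ = 0 := congrArg Prod.snd h0
    have : Nonempty X := ⟨x₀⟩
    obtain ⟨hr, hr'⟩ := harmonic_of_isIrreducible hW hI (h := fun x => (h x).re) (l := m.re)
      fun y => by simpa using congrArg Complex.re (h1 y)
    obtain ⟨hi, hi'⟩ := harmonic_of_isIrreducible hW hI (h := fun x => (h x).im) (l := m.im)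
      fun y => by simpa using congrArg Complex.im (h1 y)
    refine Prod.ext (funext fun x => ?_) (Complex.ext hr hi)
    exact Complex.ext ((hr' x x₀).trans (by simp [h2])) ((hi' x x₀).trans (by simp [h2]))
  exact ⟨(LinearEquiv.ofInjectiveEndo (L : _ →ₗ[ℂ] _) hinj).toContinuousLinearEquiv,
    by ext <;> simp⟩

/-- Near `0`, the tilted matrix of an irreducible chain has an analytic eigenvalue through `1`, with
a left eigenvector through the all-ones vector; both are real for real tilts. -/
theorem exists_analytic_eigenpair {X : Type*} [Fintype X] [DecidableEq X] [Nonempty X]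
    {W : Matrix X X ℝ} (hW : IsTransitionMatrix W) (hI : W.IsIrreducible) (g : X → X → ℝ) :
    ∃ (u : ℂ → X → ℂ) (lam : ℂ → ℂ), ContinuousAt u 0 ∧ AnalyticAt ℂ lam 0 ∧ u 0 = 1 ∧ lam 0 = 1 ∧
      (∀ᶠ z in 𝓝 (0 : ℂ), ∀ y,
        ∑ x, u z x * (W x y * Complex.exp (z * g x y)) = lam z * u z y) ∧
      ∀ᶠ s : ℝ in 𝓝 0, (∀ x, (u s x).im = 0) ∧ (lam s).im = 0 := by
  obtain ⟨x₀⟩ := ‹Nonempty X›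
  have hC : ContDiffAt ℂ ⊤ (tiltedEigenMap W g x₀) (0, (1, 1)) :=
    (contDiff_tiltedEigenMap W g x₀).contDiffAt
  have hinv := isInvertible_fderiv_tiltedEigenMap hW hI g x₀
  have htop : (⊤ : WithTop ℕ∞) ≠ 0 := by simp
  set ψ := hC.implicitFunction htop hinv with hψ
  have hψ0 : ψ 0 = (1, 1) := hC.implicitFunction_apply_self htop hinv
  have hψC : ContDiffAt ℂ ⊤ ψ 0 := hC.contDiffAt_implicitFunction htop hinv
  have hev : ∀ᶠ z in 𝓝 (0 : ℂ), tiltedEigenMap W g x₀ (z, ψ z) = (0, 1) := by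
    have := hC.eventually_apply_implicitFunction htop hinv
    rwa [tiltedEigenMap_zero_one hW] at this
  have huniq := hC.eventually_apply_eq_iff_implicitFunction htop hinv
  rw [tiltedEigenMap_zero_one hW] at huniq
  refine ⟨fun z => (ψ z).1, fun z => (ψ z).2, hψC.continuousAt.fst, hψC.snd.analyticAt,
    by simp [hψ0], by simp [hψ0], ?_, ?_⟩
  · filter_upwards [hev] with z hz y
    have := congrFun (congrArg Prod.fst hz) y
    simpa [tiltedEigenMap, sub_eq_zero] using this
  · -- The conjugate of the solution solves the same equations, so local uniqueness applies.
    have hof : Tendsto (fun s : ℝ => (s : ℂ)) (𝓝 0) (𝓝 0) := by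
      simpa using Complex.continuous_ofReal.tendsto 0
    have hψr : Tendsto (fun s : ℝ => ψ s) (𝓝 0) (𝓝 (1, 1)) := by
      have := hψC.continuousAt.tendsto.comp hof
      rwa [hψ0] at this
    have hconj : Tendsto (fun s : ℝ => ((s : ℂ), (star (ψ s).1, star (ψ s).2))) (𝓝 0)
        (𝓝 (0, (1, 1))) := by
      have h1 := (continuous_star.tendsto (1 : X → ℂ)).comp hψr.fst_nhds
      have h2 := (continuous_star.tendsto (1 : ℂ)).comp hψr.snd_nhds
      rw [star_one] at h1 h2
      exact hof.prodMk_nhds (h1.prodMk_nhds h2)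
    filter_upwards [hconj.eventually huniq, hof.eventually hev] with s h1 h2
    have h3 : tiltedEigenMap W g x₀ ((s : ℂ), (star (ψ s).1, star (ψ s).2)) = (0, 1) := by
      have h4 := congrArg (fun q => (star q.1, star q.2)) h2
      refine Eq.trans ?_ (h4.trans (by simp))
      refine Prod.ext (funext fun y => ?_) rfl
      simp [tiltedEigenMap, ← Complex.exp_conj]
    have h4 := h1.1 h3
    refine ⟨fun x => Complex.conj_eq_iff_im.1 ?_, Complex.conj_eq_iff_im.1 ?_⟩
    · exact (congrFun (congrArg Prod.fst h4) x).symm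
    · exact (congrArg Prod.snd h4).symm

/-- Near `0`, the logarithm of the analytic eigenvalue extends the potential of the generator. -/
theorem eventually_log_eq_markovPotential {X : Type*} [Fintype X] [DecidableEq X] [Nonempty X]
    {W : Matrix X X ℝ} (hW : IsTransitionMatrix W) {g : X → X → ℝ} {u : ℂ → X → ℂ} {lam : ℂ → ℂ}
    (hu : ContinuousAt u 0) (hl : ContinuousAt lam 0) (hu0 : u 0 = 1) (hl0 : lam 0 = 1)
    (heig : ∀ᶠ z in 𝓝 (0 : ℂ), ∀ y,
        ∑ x, u z x * (W x y * Complex.exp (z * g x y)) = lam z * u z y)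
    (hreal : ∀ᶠ s : ℝ in 𝓝 0, (∀ x, (u s x).im = 0) ∧ (lam s).im = 0) :
    ∀ᶠ s : ℝ in 𝓝 0, Complex.log (lam s) = (markovPotential W g s : ℂ) := by
  have hof : Tendsto (fun s : ℝ => (s : ℂ)) (𝓝 0) (𝓝 0) := by
    simpa using Complex.continuous_ofReal.tendsto 0
  have hupos : ∀ᶠ s : ℝ in 𝓝 0, ∀ x, 0 < (u s x).re := by
    refine eventually_all.2 fun x => ?_
    have h1 : Tendsto (fun s : ℝ => (u s x).re) (𝓝 0) (𝓝 1) := by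
      have h2 := (Complex.continuous_re.tendsto (u 0 x)).comp
        ((tendsto_pi_nhds.1 hu.tendsto x).comp hof)
      simpa [hu0] using! h2
    exact h1.eventually (lt_mem_nhds one_pos)
  have hlpos : ∀ᶠ s : ℝ in 𝓝 0, 0 < (lam s).re := by
    have h1 : Tendsto (fun s : ℝ => (lam s).re) (𝓝 0) (𝓝 1) := by
      have h2 := (Complex.continuous_re.tendsto (lam 0)).comp (hl.tendsto.comp hof)
      simpa [hl0] using! h2
    exact h1.eventually (lt_mem_nhds one_pos)
  filter_upwards [hupos, hlpos, hof.eventually heig, hreal] with s h1 h2 h3 h4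
  have hus : ∀ x, u s x = ((u s x).re : ℂ) := fun x => Complex.ext rfl (by simp [h4.1 x])
  have hls : lam s = ((lam s).re : ℂ) := Complex.ext rfl (by simp [h4.2])
  have hp : perronEigenvalue (Matrix.of fun x y => W x y * Real.exp (s * g x y)) = (lam s).re := by
    refine perronEigenvalue_eq_of_pos_eigenvector
      (fun x y => mul_nonneg (hW.1 x y) (Real.exp_pos _).le) h1 fun y => ?_
    refine Complex.ofReal_injective ?_
    push_cast
    simp only [← hus, ← hls]
    exact h3 y
  rw [markovPotential, hp, hls, ← Complex.ofReal_log h2.le, Complex.ofReal_re]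

/-! ### Taylor expansion of an analytic function that is real on the real line -/

theorem deriv_ofReal_eventuallyEq {f : ℂ → ℂ} {φ : ℝ → ℝ} (hf : AnalyticAt ℂ f 0)
    (h : ∀ᶠ s : ℝ in 𝓝 0, f s = φ s) : ∀ᶠ s : ℝ in 𝓝 0, deriv f s = ((deriv φ s : ℝ) : ℂ) := by
  have hof : Tendsto (fun s : ℝ => (s : ℂ)) (𝓝 0) (𝓝 0) := by
    simpa using Complex.continuous_ofReal.tendsto 0
  filter_upwards [h.eventually_nhds, hof.eventually hf.eventually_analyticAt] with s h1 h2
  have h3 := h2.differentiableAt.hasDerivAt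
  have h4 : HasDerivAt φ (deriv f s).re s :=
    h3.real_of_complex.congr_of_eventuallyEq (h1.mono fun x hx => by simp [hx])
  have h5 := h4.ofReal_comp
  have h6 : HasDerivAt (fun x : ℝ => (φ x : ℂ)) (deriv f s) s :=
    h3.comp_ofReal.congr_of_eventuallyEq (h1.mono fun x hx => hx.symm)
  rw [h4.deriv, h5.unique h6]

theorem contDiffAt_of_ofReal_eventuallyEq {f : ℂ → ℂ} {φ : ℝ → ℝ} (hf : AnalyticAt ℂ f 0)
    (h : ∀ᶠ s : ℝ in 𝓝 0, f s = φ s) {n : WithTop ℕ∞} : ContDiffAt ℝ n φ 0 := by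
  have h1 : ContDiffAt ℝ n (fun s : ℝ => (f s).re) 0 :=
    ContDiffAt.real_of_complex (by simpa using hf.contDiffAt)
  exact h1.congr_of_eventuallyEq (h.mono fun x hx => by simp [hx])

/-- The second-order Taylor expansion of an analytic function at `0` has the Taylor coefficients of
its restriction to the real line, if this restriction is real. -/
theorem isLittleO_taylor_two {f : ℂ → ℂ} {φ : ℝ → ℝ} (hf : AnalyticAt ℂ f 0)
    (h : ∀ᶠ s : ℝ in 𝓝 0, f s = φ s) :
    (fun z => f z - (φ 0 + deriv φ 0 * z + iteratedDeriv 2 φ 0 / 2 * z ^ 2))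
      =o[𝓝 0] fun z => z ^ 2 := by
  have hd1 := deriv_ofReal_eventuallyEq hf h
  have hd2 := deriv_ofReal_eventuallyEq hf.deriv hd1
  have e0 : f 0 = φ 0 := by simpa using h.self_of_nhds
  have e1 : deriv f 0 = ((deriv φ 0 : ℝ) : ℂ) := by simpa using hd1.self_of_nhds
  have e2 : iteratedDeriv 2 f 0 = ((iteratedDeriv 2 φ 0 : ℝ) : ℂ) := by
    simpa [iteratedDeriv_succ, iteratedDeriv_zero] using hd2.self_of_nhds
  have h1 := hf.hasFPowerSeriesAt.isBigO_sub_partialSum_pow 3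
  have h2 : (fun z : ℂ => ‖z‖ ^ 3) =o[𝓝 0] fun z : ℂ => z ^ 2 := by
    have h3 := (isLittleO_pow_pow (𝕜 := ℂ) (show 2 < 3 by norm_num)).norm_left
    simpa using h3
  refine (h1.trans_isLittleO h2).congr_left fun z => ?_
  simp [FormalMultilinearSeries.partialSum, Finset.sum_range_succ, e0, e1, e2, Nat.factorial,
    iteratedDeriv_one]
  ring

/-! ### Laws of finitely supported random variables -/

/-- The law on `ℝ` of a function `f` on a finite set with weights `p`. -/
noncomputable def weightedLaw {Ω : Type*} [Fintype Ω] (p : Ω → ℝ) (f : Ω → ℝ) :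
    MeasureTheory.Measure ℝ :=
  ∑ ω, ENNReal.ofReal (p ω) • MeasureTheory.Measure.dirac (f ω)

theorem isProbabilityMeasure_weightedLaw {Ω : Type*} [Fintype Ω] {p : Ω → ℝ} (hp : ∀ ω, 0 ≤ p ω)
    (h1 : ∑ ω, p ω = 1) (f : Ω → ℝ) :
    MeasureTheory.IsProbabilityMeasure (weightedLaw p f) := by
  constructor
  simp [weightedLaw, ← ENNReal.ofReal_sum_of_nonneg fun ω _ => hp ω, h1]

theorem charFun_weightedLaw {Ω : Type*} [Fintype Ω] {p : Ω → ℝ} (hp : ∀ ω, 0 ≤ p ω) (f : Ω → ℝ)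
    (t : ℝ) : MeasureTheory.charFun (weightedLaw p f) t
      = ∑ ω, (p ω : ℂ) * Complex.exp (t * f ω * Complex.I) := by
  rw [MeasureTheory.charFun_apply_real, weightedLaw, MeasureTheory.integral_finsetSum_measure]
  · refine Finset.sum_congr rfl fun ω _ => ?_
    rw [MeasureTheory.integral_smul_measure, MeasureTheory.integral_dirac,
      ENNReal.toReal_ofReal (hp ω)]
    simp
  · intro ω _
    exact (MeasureTheory.integrable_dirac (by simp)).smul_measure ENNReal.ofReal_ne_top

theorem cdf_weightedLaw {Ω : Type*} [Fintype Ω] {p : Ω → ℝ} (hp : ∀ ω, 0 ≤ p ω)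
    (h1 : ∑ ω, p ω = 1) (f : Ω → ℝ) (a : ℝ) :
    cdf (weightedLaw p f) a = ∑ ω with f ω ≤ a, p ω := by
  have := isProbabilityMeasure_weightedLaw hp h1 f
  rw [cdf_eq_real, MeasureTheory.measureReal_def, weightedLaw,
    MeasureTheory.Measure.finsetSum_apply, ENNReal.toReal_sum, Finset.sum_filter]
  · refine Finset.sum_congr rfl fun ω _ => ?_
    by_cases h : f ω ≤ a <;> simp [h, hp ω]
  · intro ω _
    by_cases h : f ω ≤ a <;> simp [h]

/-- Convergence of distribution functions, from Lévy's continuity theorem, at a point that is not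
an atom of the limit. -/
theorem tendsto_cdf_of_tendsto_charFun {μ : ℕ → MeasureTheory.Measure ℝ}
    {ν : MeasureTheory.Measure ℝ} (hμ : ∀ n, MeasureTheory.IsProbabilityMeasure (μ n))
    [hν : MeasureTheory.IsProbabilityMeasure ν]
    (h : ∀ t, Tendsto (fun n => MeasureTheory.charFun (μ n) t) atTop
      (𝓝 (MeasureTheory.charFun ν t)))
    {a : ℝ} (ha : ν {a} = 0) : Tendsto (fun n => cdf (μ n) a) atTop (𝓝 (cdf ν a)) := by
  let μ' : ℕ → MeasureTheory.ProbabilityMeasure ℝ := fun n => ⟨μ n, hμ n⟩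
  let ν' : MeasureTheory.ProbabilityMeasure ℝ := ⟨ν, hν⟩
  have h1 : Tendsto μ' atTop (𝓝 ν') :=
    MeasureTheory.ProbabilityMeasure.tendsto_of_tendsto_charFun h
  have h2 := MeasureTheory.ProbabilityMeasure.tendsto_measure_of_null_frontier_of_tendsto' h1
    (E := Set.Iic a) (by simpa [frontier_Iic] using! ha)
  have h3 := (ENNReal.tendsto_toReal (MeasureTheory.measure_ne_top ν (Set.Iic a))).comp h2
  simp only [cdf_eq_real]
  exact h3

/-! ### The central limit theorem for a Markov chain -/

/-- The additive functional `∑ᵢ g(wᵢ₊₁, wᵢ)` of a path. -/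
def pathSum {X : Type*} (g : X → X → ℝ) (n : ℕ) (w : Fin (n + 1) → X) : ℝ :=
  ∑ i : Fin n, g (w i.succ) (w i.castSucc)

theorem markovPathLaw_nonneg {X : Type*} [Fintype X] [DecidableEq X] {W : Matrix X X ℝ}
    (hW : IsTransitionMatrix W) {P : X → ℝ} (hP : P ∈ stdSimplex ℝ X) (n : ℕ)
    (w : Fin (n + 1) → X) : 0 ≤ markovPathLaw W P n w :=
  mul_nonneg (hP.1 _) (Finset.prod_nonneg fun _ _ => hW.1 _ _)

theorem sum_markovPathLaw {X : Type*} [Fintype X] [DecidableEq X] {W : Matrix X X ℝ}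
    (hW : IsTransitionMatrix W) {P : X → ℝ} (hP : P ∈ stdSimplex ℝ X) (n : ℕ) :
    ∑ w, markovPathLaw W P n w = 1 := by
  have := sum_path_of_eigenvector P (fun _ => 1) (M := W) (l := 1)
    (by simpa using (mem_colStochastic_iff_sum.1 hW).2) n
  simpa [markovPathLaw, hP.2] using this

theorem markovPathLaw_mul_exp {X : Type*} (W : Matrix X X ℝ) (P : X → ℝ) (g : X → X → ℝ) (n : ℕ)
    (w : Fin (n + 1) → X) (z : ℂ) :
    (markovPathLaw W P n w : ℂ) * Complex.exp (z * pathSum g n w)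
      = P (w 0) * ∏ i : Fin n, ((W (w i.succ) (w i.castSucc) : ℂ)
        * Complex.exp (z * g (w i.succ) (w i.castSucc))) := by
  rw [Finset.prod_mul_distrib, ← Complex.exp_sum, ← Finset.mul_sum, pathSum, markovPathLaw]
  push_cast
  ring

/-- The characteristic functions of the centred and rescaled path sums converge to those of the
normal law. The eigenvector identity gives the expectation of `exp (z * pathSum) * u z (w n)` in
closed form, and `u z` tends to `1`. -/
theorem tendsto_charFun_pathSum {X : Type*} [Fintype X] [DecidableEq X]
    {W : Matrix X X ℝ} (hW : IsTransitionMatrix W) {P : X → ℝ} (hP : P ∈ stdSimplex ℝ X)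
    (g : X → X → ℝ) {u : ℂ → X → ℂ} {lam : ℂ → ℂ} (hu : ContinuousAt u 0) (hu0 : u 0 = 1)
    (heig : ∀ᶠ z in 𝓝 (0 : ℂ), ∀ y,
        ∑ x, u z x * (W x y * Complex.exp (z * g x y)) = lam z * u z y)
    (hl : ∀ᶠ z in 𝓝 (0 : ℂ), lam z ≠ 0) {D V : ℝ}
    (hexp : (fun z => Complex.log (lam z) - (D * z + V / 2 * z ^ 2)) =o[𝓝 0] fun z => z ^ 2)
    (t : ℝ) :
    Tendsto (fun n : ℕ => MeasureTheory.charFun (weightedLaw (markovPathLaw W P n)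
      (fun w => (pathSum g n w - n * D) / √n)) t) atTop (𝓝 (Complex.exp (-(V * t ^ 2 / 2)))) := by
  set z : ℕ → ℂ := fun n => ((t / √n : ℝ) : ℂ) * Complex.I with hz
  have hz0 : Tendsto z atTop (𝓝 0) := by
    have h1 : Tendsto (fun n : ℕ => t / √(n : ℝ)) atTop (𝓝 0) :=
      (Real.tendsto_sqrt_atTop.comp tendsto_natCast_atTop_atTop).const_div_atTop t
    have h2 := ((Complex.continuous_ofReal.tendsto 0).comp h1).mul_const Complex.I
    simpa [hz, Function.comp_def] using h2
  have hnz : ∀ n : ℕ, 0 < n → (n : ℂ) * z n ^ 2 = -(t : ℂ) ^ 2 := by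
    intro n hn
    have h1 : ((√(n : ℝ) : ℝ) : ℂ) ^ 2 = n := by
      rw [← Complex.ofReal_pow, Real.sq_sqrt (Nat.cast_nonneg n)]; simp
    have h2 : (n : ℂ) ≠ 0 := by exact_mod_cast hn.ne'
    simp only [hz, mul_pow, Complex.I_sq, Complex.ofReal_div, div_pow, h1]
    field_simp
  have hU : Tendsto (fun n => u (z n)) atTop (𝓝 1) := by
    have := hu.tendsto.comp hz0
    rwa [hu0] at this
  -- The exponent of `lam (z n) ^ n` after centring.
  have hlog : Tendsto (fun n : ℕ => (n : ℂ) * (Complex.log (lam (z n)) - D * z n)) atTop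
      (𝓝 (-(V * t ^ 2 / 2))) := by
    have h1 := hexp.comp_tendsto hz0
    have h2 : (fun n : ℕ => (n : ℂ) * (Complex.log (lam (z n)) - (D * z n + V / 2 * z n ^ 2)))
        =o[atTop] fun n : ℕ => (n : ℂ) * z n ^ 2 :=
      (isBigO_refl (fun n : ℕ => (n : ℂ)) atTop).mul_isLittleO h1
    have h3 : (fun n : ℕ => (n : ℂ) * z n ^ 2) =O[atTop] fun _ => (1 : ℂ) := by
      have h4 : Tendsto (fun n : ℕ => (n : ℂ) * z n ^ 2) atTop (𝓝 (-(t : ℂ) ^ 2)) :=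
        tendsto_const_nhds.congr' (by
          filter_upwards [eventually_gt_atTop 0] with n hn using (hnz n hn).symm)
      exact h4.isBigO_one ℂ
    have h5 := (isLittleO_one_iff ℂ).1 (h2.trans_isBigO h3)
    have h6 := h5.add_const (-(V * t ^ 2 / 2 : ℂ))
    rw [zero_add] at h6
    refine h6.congr' ?_
    filter_upwards [eventually_gt_atTop 0] with n hn
    linear_combination (-V / 2 : ℂ) * hnz n hn
  have hmain : Tendsto (fun n : ℕ =>
      Complex.exp ((n : ℂ) * (Complex.log (lam (z n)) - D * z n)) * ∑ x, (P x : ℂ) * u (z n) x)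
      atTop (𝓝 (Complex.exp (-(V * t ^ 2 / 2)))) := by
    have h1 : Tendsto (fun n : ℕ => ∑ x, (P x : ℂ) * u (z n) x) atTop (𝓝 1) := by
      have h2 : Tendsto (fun n : ℕ => ∑ x, (P x : ℂ) * u (z n) x) atTop
          (𝓝 (∑ x, (P x : ℂ) * 1)) :=
        tendsto_finsetSum _ fun x _ => (tendsto_pi_nhds.1 hU x).const_mul _
      have h3 : (∑ x, (P x : ℂ)) = 1 := by exact_mod_cast hP.2
      simpa [h3] using h2
    simpa using (Complex.continuous_exp.continuousAt.tendsto.comp hlog).mul h1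
  have hdiff : Tendsto (fun n : ℕ => MeasureTheory.charFun (weightedLaw (markovPathLaw W P n)
      (fun w => (pathSum g n w - n * D) / √n)) t
      - Complex.exp ((n : ℂ) * (Complex.log (lam (z n)) - D * z n)) * ∑ x, (P x : ℂ) * u (z n) x)
      atTop (𝓝 0) := by
    have hb : Tendsto (fun n => ‖1 - u (z n)‖) atTop (𝓝 0) := by
      simpa using (hU.const_sub 1).norm
    refine squeeze_zero_norm' ?_ hb
    filter_upwards [hz0.eventually heig, hz0.eventually hl, eventually_gt_atTop 0] with n h1 h2 hn
    have hpath := sum_path_of_eigenvector (fun x => (P x : ℂ)) (u (z n))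
      (M := fun x y => (W x y : ℂ) * Complex.exp (z n * g x y)) h1 n
    simp only [← markovPathLaw_mul_exp] at hpath
    have hcent : ∀ w, Complex.exp (t * ((pathSum g n w - n * D) / √n : ℝ) * Complex.I)
        = Complex.exp (-(n * (D * z n))) * Complex.exp (z n * pathSum g n w) := by
      intro w
      rw [← Complex.exp_add]
      congr 1
      simp only [hz]
      push_cast
      ring
    have hpow : Complex.exp ((n : ℂ) * (Complex.log (lam (z n)) - D * z n))
        = Complex.exp (-(n * (D * z n))) * lam (z n) ^ n := by
      rw [mul_sub, sub_eq_add_neg, Complex.exp_add, Complex.exp_nat_mul, Complex.exp_log h2,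
        mul_comm]
    rw [charFun_weightedLaw (markovPathLaw_nonneg hW hP n), hpow, mul_assoc, ← hpath,
      Finset.mul_sum, ← Finset.sum_sub_distrib]
    calc _ = ‖∑ w, (markovPathLaw W P n w : ℂ)
            * Complex.exp (t * ((pathSum g n w - n * D) / √n : ℝ) * Complex.I)
            * (1 - u (z n) (w (Fin.last n)))‖ := by
          congr 1
          refine Finset.sum_congr rfl fun w _ => ?_
          rw [hcent w]
          ring
      _ ≤ ∑ w, markovPathLaw W P n w * ‖1 - u (z n)‖ := by
          refine (norm_sum_le _ _).trans (Finset.sum_le_sum fun w _ => ?_)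
          rw [norm_mul, norm_mul, ← Complex.ofReal_mul, Complex.norm_exp_ofReal_mul_I, mul_one,
            Complex.norm_real, Real.norm_of_nonneg (markovPathLaw_nonneg hW hP n w)]
          exact mul_le_mul_of_nonneg_left (norm_le_pi_norm (1 - u (z n)) _)
            (markovPathLaw_nonneg hW hP n w)
      _ = ‖1 - u (z n)‖ := by rw [← Finset.sum_mul, sum_markovPathLaw hW hP, one_mul]
  simpa using hdiff.add hmain

/-- The potential of a generator is smooth at `0`, its second derivative there is the asymptotic
variance of the path sums, and these satisfy the central limit theorem. -/
theorem markovPotential_contDiffAt_and_clt {X : Type*} [Fintype X] [DecidableEq X]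
    {W : Matrix X X ℝ} (hW : IsTransitionMatrix W) (hI : W.IsIrreducible) {P : X → ℝ}
    (hP : P ∈ stdSimplex ℝ X) (g : X → X → ℝ) :
    ContDiffAt ℝ 2 (markovPotential W g) 0 ∧ 0 ≤ iteratedDeriv 2 (markovPotential W g) 0 ∧
    ∀ a : ℝ, gaussianReal 0 (iteratedDeriv 2 (markovPotential W g) 0).toNNReal {a} = 0 →
      Tendsto (fun n : ℕ =>
        ∑ w with pathSum g n w ≤ n * deriv (markovPotential W g) 0 + √n * a, markovPathLaw W P n w)
        atTop (𝓝 (cdf (gaussianReal 0 (iteratedDeriv 2 (markovPotential W g) 0).toNNReal) a)) := by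
  have : Nonempty X := by
    by_contra hX
    have := not_nonempty_iff.1 hX
    simpa using hP.2
  obtain ⟨u, lam, hu, hlam, hu0, hl0, heig, hreal⟩ := exists_analytic_eigenpair hW hI g
  have hφ := eventually_log_eq_markovPotential hW hu hlam.continuousAt hu0 hl0 heig hreal
  have hlog : AnalyticAt ℂ (fun z => Complex.log (lam z)) 0 := hlam.clog (by simp [hl0])
  have hexp := isLittleO_taylor_two hlog hφ
  have hφ0 : markovPotential W g 0 = 0 := by
    have := hφ.self_of_nhds
    simpa [hl0] using this.symm
  set D := deriv (markovPotential W g) 0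
  set V := iteratedDeriv 2 (markovPotential W g) 0
  have hlne : ∀ᶠ z in 𝓝 (0 : ℂ), lam z ≠ 0 := hlam.continuousAt.eventually_ne (by simp [hl0])
  have hchar := tendsto_charFun_pathSum hW hP g hu hu0 heig hlne (D := D) (V := V)
    (by simpa [hφ0] using hexp)
  have hprob : ∀ n : ℕ, MeasureTheory.IsProbabilityMeasure (weightedLaw (markovPathLaw W P n)
      (fun w => (pathSum g n w - n * D) / √n)) := fun n =>
    isProbabilityMeasure_weightedLaw (markovPathLaw_nonneg hW hP n) (sum_markovPathLaw hW hP n) _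
  -- A characteristic function is bounded by `1`, and so is its limit `exp (-V t ^ 2 / 2)`.
  have hV : 0 ≤ V := by
    have h1 := le_of_tendsto (hchar 1).norm (Eventually.of_forall fun n =>
      MeasureTheory.norm_charFun_le_one (μ := weightedLaw (markovPathLaw W P n)
        (fun w => (pathSum g n w - n * D) / √n)) 1)
    rw [Complex.norm_exp, Real.exp_le_one_iff] at h1
    have h2 : (-((V : ℂ) * (1 : ℝ) ^ 2 / 2)).re = -(V / 2) := by
      rw [show -((V : ℂ) * (1 : ℝ) ^ 2 / 2) = ((-(V / 2) : ℝ) : ℂ) by push_cast; ring,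
        Complex.ofReal_re]
    rw [h2] at h1
    linarith
  refine ⟨contDiffAt_of_ofReal_eventuallyEq hlog hφ, hV, fun a ha => ?_⟩
  have h1 := tendsto_cdf_of_tendsto_charFun (ν := gaussianReal 0 V.toNNReal) hprob (fun t => by
    rw [charFun_gaussianReal]
    convert hchar t using 3
    simp [Real.coe_toNNReal V hV]) ha
  refine h1.congr' ?_
  filter_upwards [eventually_gt_atTop 0] with n hn
  rw [cdf_weightedLaw (markovPathLaw_nonneg hW hP n) (sum_markovPathLaw hW hP n)]
  refine Finset.sum_congr (Finset.filter_congr fun w _ => ?_) fun _ _ => rfl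
  rw [div_le_iff₀ (Real.sqrt_pos.2 (Nat.cast_pos.2 hn)), sub_le_iff_le_add, add_comm, mul_comm a]

/-! ### Quantiles of the normal law -/

theorem strictMono_cdf_gaussianReal {v : NNReal} (hv : v ≠ 0) :
    StrictMono (cdf (gaussianReal 0 v)) := by
  intro a b hab
  rw [cdf_eq_real, cdf_eq_real, ← Set.Iic_union_Ioc_eq_Iic hab.le,
    MeasureTheory.measureReal_union (Set.Iic_disjoint_Ioc le_rfl) measurableSet_Ioc]
  refine lt_add_of_pos_right _ (ENNReal.toReal_pos (fun h => ?_) (MeasureTheory.measure_ne_top _ _))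
  have := gaussianReal_absolutelyContinuous' 0 hv h
  simp only [Real.volume_Ioc, ENNReal.ofReal_eq_zero] at this
  linarith

theorem cdf_gaussianReal_mul {c : ℝ} (hc : 0 < c) (v : NNReal) (y : ℝ) :
    cdf (gaussianReal 0 (.mk (c ^ 2) (sq_nonneg _) * v)) (c * y) = cdf (gaussianReal 0 v) y := by
  have h := gaussianReal_map_const_mul (μ := 0) (v := v) c
  rw [mul_zero] at h
  rw [cdf_eq_real, cdf_eq_real, ← h, MeasureTheory.map_measureReal_apply (by fun_prop)
    measurableSet_Iic]
  congr 1
  ext x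
  exact mul_le_mul_iff_right₀ hc

/-- The point `√v * gaussianQuantile ε` separates the points where the distribution function of the
centred normal law of variance `v` is below and above `ε`, also for `v = 0`, where the law is the
Dirac mass at `0`. -/
theorem cdf_gaussianReal_quantile {ε : ℝ} (hε₀ : 0 < ε) (hε₁ : ε < 1) (v : NNReal) {δ : ℝ}
    (hδ : 0 < δ) :
    cdf (gaussianReal 0 v) (√(v : ℝ) * gaussianQuantile ε - δ) < ε ∧
    ε < cdf (gaussianReal 0 v) (√(v : ℝ) * gaussianQuantile ε + δ) ∧
    gaussianReal 0 v {√(v : ℝ) * gaussianQuantile ε - δ} = 0 ∧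
    gaussianReal 0 v {√(v : ℝ) * gaussianQuantile ε + δ} = 0 := by
  rcases eq_or_ne v 0 with rfl | hv
  · simp [gaussianReal_zero_var, cdf_eq_real, MeasureTheory.measureReal_def, hδ, hδ.le, hδ.ne', hε₀,
      hε₁]
  have hbdd : BddBelow {y : ℝ | ε ≤ cdf (gaussianReal 0 1) y} := by
    obtain ⟨y, hy⟩ := ((tendsto_cdf_atBot (gaussianReal 0 1)).eventually (gt_mem_nhds hε₀)).exists
    exact ⟨y, fun x hx => le_of_not_gt fun hxy =>
      (hx.trans (monotone_cdf _ hxy.le)).not_gt hy⟩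
  have hne : {y : ℝ | ε ≤ cdf (gaussianReal 0 1) y}.Nonempty := by
    obtain ⟨y, hy⟩ := ((tendsto_cdf_atTop (gaussianReal 0 1)).eventually (lt_mem_nhds hε₁)).exists
    exact ⟨y, hy.le⟩
  have hlt : ∀ y < gaussianQuantile ε, cdf (gaussianReal 0 1) y < ε := fun y hy =>
    not_le.1 fun h => (csInf_le hbdd h).not_gt hy
  have hgt : ∀ y > gaussianQuantile ε, ε < cdf (gaussianReal 0 1) y := fun y hy => by
    obtain ⟨x, hx, hxy⟩ := exists_lt_of_csInf_lt hne hy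
    exact lt_of_le_of_lt hx (strictMono_cdf_gaussianReal one_ne_zero hxy)
  have hc : 0 < √(v : ℝ) := Real.sqrt_pos.2 (by exact_mod_cast pos_iff_ne_zero.2 hv)
  have hv' : v = .mk (√(v : ℝ) ^ 2) (sq_nonneg _) * 1 := by
    ext
    simp
  have hscale : ∀ y, cdf (gaussianReal 0 v) y = cdf (gaussianReal 0 1) (y / √(v : ℝ)) := fun y => by
    rw [← cdf_gaussianReal_mul hc 1, ← hv', mul_div_cancel₀ _ hc.ne']
  have := nullSingletonClass_gaussianReal (μ := 0) hv
  refine ⟨?_, ?_, by simp, by simp⟩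
  · rw [hscale]
    exact hlt _ ((div_lt_iff₀ hc).2 (by linarith))
  · rw [hscale]
    exact hgt _ ((lt_div_iff₀ hc).2 (by linarith))

/-! ### One-shot bounds for the second error probability -/

theorem betaErrorDet_le_exp {Ω : Type*} [Fintype Ω] {ε a : ℝ} {Q₁ Q₀ S : Ω → ℝ}
    (h0 : ∀ ω, 0 ≤ Q₀ ω) (hs : ∑ ω, Q₀ ω = 1) (hexp : ∑ ω, Q₀ ω * Real.exp (S ω) = 1)
    (h1 : ∑ ω with S ω ≤ a, Q₁ ω ≤ ε) : betaErrorDet ε Q₁ Q₀ ≤ Real.exp (-a) := by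
  have hbdd : BddBelow {b : ℝ | ∃ S : Finset Ω, ∑ ω ∈ S, Q₁ ω ≤ ε ∧ b = 1 - ∑ ω ∈ S, Q₀ ω} := by
    refine ⟨0, ?_⟩
    rintro b ⟨A, -, rfl⟩
    have := Finset.sum_le_sum_of_subset_of_nonneg (Finset.subset_univ A) fun ω _ _ => h0 ω
    linarith
  refine (csInf_le hbdd ⟨_, h1, rfl⟩).trans ?_
  rw [← hs, ← Finset.sum_filter_add_sum_filter_not Finset.univ (fun ω => S ω ≤ a) Q₀,
    add_sub_cancel_left]
  calc ∑ ω with ¬ S ω ≤ a, Q₀ ω ≤ ∑ ω with ¬ S ω ≤ a, Real.exp (-a) * (Q₀ ω * Real.exp (S ω)) := by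
        refine Finset.sum_le_sum fun ω hω => ?_
        have h2 : a < S ω := not_le.1 (Finset.mem_filter.1 hω).2
        have h3 : 1 ≤ Real.exp (-a) * Real.exp (S ω) := by
          rw [← Real.exp_add, Real.one_le_exp_iff]
          linarith
        nlinarith [mul_le_mul_of_nonneg_left h3 (h0 ω)]
    _ ≤ ∑ ω, Real.exp (-a) * (Q₀ ω * Real.exp (S ω)) :=
        Finset.sum_le_sum_of_subset_of_nonneg (Finset.subset_univ _) fun ω _ _ =>
          mul_nonneg (Real.exp_pos _).le (mul_nonneg (h0 ω) (Real.exp_pos _).le)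
    _ = Real.exp (-a) := by rw [← Finset.mul_sum, hexp, mul_one]

theorem betaError_le_betaErrorDet {Ω : Type*} [Fintype Ω] {ε : ℝ} (hε : 0 ≤ ε) {Q₁ Q₀ : Ω → ℝ}
    (hs : ∑ ω, Q₀ ω = 1) : betaError ε Q₁ Q₀ ≤ betaErrorDet ε Q₁ Q₀ := by
  classical
  refine csInf_le_csInf ⟨_, (betaError_isLeast hε Q₁ Q₀).2⟩ ⟨_, ∅, by simpa using hε, rfl⟩ ?_
  rintro b ⟨A, hA, rfl⟩
  refine ⟨fun ω => if ω ∈ A then 1 else 0, fun ω => ?_, ?_, ?_⟩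
  · dsimp only
    split_ifs <;> simp
  · simpa using hA
  · simp [mul_sub, hs]

/-- The converse bound: where the likelihood ratio is at most `C * exp a`, a test that accepts with
small `Q₁`-probability must leave a proportional `Q₀`-probability. -/
theorem sub_le_mul_betaError {Ω : Type*} [Fintype Ω] {ε a C : ℝ} (hε : 0 ≤ ε) (hC : 0 ≤ C)
    {Q₁ Q₀ S : Ω → ℝ} (h0 : ∀ ω, 0 ≤ Q₀ ω) (h1 : ∀ ω, 0 ≤ Q₁ ω)
    (hr : ∀ ω, Q₁ ω ≤ C * Real.exp (S ω) * Q₀ ω) :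
    ∑ ω with S ω ≤ a, Q₁ ω - ε ≤ C * Real.exp a * betaError ε Q₁ Q₀ := by
  obtain ⟨T, hT, hT1, hb⟩ := (betaError_isLeast hε Q₁ Q₀).1
  have h2 : ∑ ω with S ω ≤ a, Q₁ ω * T ω ≤ ε :=
    (Finset.sum_le_sum_of_subset_of_nonneg (Finset.subset_univ _) fun ω _ _ =>
      mul_nonneg (h1 ω) (hT ω).1).trans hT1
  calc ∑ ω with S ω ≤ a, Q₁ ω - ε ≤ ∑ ω with S ω ≤ a, Q₁ ω * (1 - T ω) := by
        simp only [mul_sub, mul_one, Finset.sum_sub_distrib]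
        linarith
    _ ≤ ∑ ω with S ω ≤ a, C * Real.exp a * (Q₀ ω * (1 - T ω)) := by
        refine Finset.sum_le_sum fun ω hω => ?_
        have h3 : S ω ≤ a := (Finset.mem_filter.1 hω).2
        rw [← mul_assoc]
        refine mul_le_mul_of_nonneg_right ((hr ω).trans ?_) (sub_nonneg.2 (hT ω).2)
        exact mul_le_mul_of_nonneg_right
          (mul_le_mul_of_nonneg_left (Real.exp_le_exp.2 h3) hC) (h0 ω)
    _ ≤ ∑ ω, C * Real.exp a * (Q₀ ω * (1 - T ω)) :=
        Finset.sum_le_sum_of_subset_of_nonneg (Finset.subset_univ _) fun ω _ _ =>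
          mul_nonneg (mul_nonneg hC (Real.exp_pos _).le)
            (mul_nonneg (h0 ω) (sub_nonneg.2 (hT ω).2))
    _ = C * Real.exp a * betaError ε Q₁ Q₀ := by rw [← Finset.mul_sum, hb]

/-- The two bounds combined: the exponents of both second error probabilities lie between quantiles
of `S` under `Q₁`, up to an additive constant. -/
theorem neg_log_betaError_bounds {Ω : Type*} [Fintype Ω] {ε a₁ a₂ C η : ℝ} (hε : 0 ≤ ε) (hC : 0 < C)
    (hη : 0 < η) {Q₁ Q₀ S : Ω → ℝ} (h0 : ∀ ω, 0 ≤ Q₀ ω) (h1 : ∀ ω, 0 ≤ Q₁ ω) (hs : ∑ ω, Q₀ ω = 1)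
    (hexp : ∑ ω, Q₀ ω * Real.exp (S ω) = 1) (hr : ∀ ω, Q₁ ω ≤ C * Real.exp (S ω) * Q₀ ω)
    (ha₁ : ∑ ω with S ω ≤ a₁, Q₁ ω ≤ ε) (ha₂ : ε + η ≤ ∑ ω with S ω ≤ a₂, Q₁ ω) :
    a₁ ≤ -Real.log (betaErrorDet ε Q₁ Q₀) ∧
    -Real.log (betaErrorDet ε Q₁ Q₀) ≤ -Real.log (betaError ε Q₁ Q₀) ∧
    -Real.log (betaError ε Q₁ Q₀) ≤ a₂ + Real.log (C / η) := by
  have hle := betaError_le_betaErrorDet hε (Q₁ := Q₁) hs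
  have hup := betaErrorDet_le_exp h0 hs hexp ha₁
  have hlow : η ≤ C * Real.exp a₂ * betaError ε Q₁ Q₀ :=
    le_trans (by linarith) (sub_le_mul_betaError (a := a₂) hε hC.le h0 h1 hr)
  have hpos : 0 < betaError ε Q₁ Q₀ :=
    pos_of_mul_pos_right (hη.trans_le hlow) (mul_pos hC (Real.exp_pos _)).le
  refine ⟨?_, neg_le_neg (Real.log_le_log hpos hle), ?_⟩
  · have := Real.log_le_log (hpos.trans_le hle) hup
    rw [Real.log_exp] at this
    linarith
  · have := Real.log_le_log hη hlow
    rw [Real.log_mul (mul_pos hC (Real.exp_pos _)).ne' hpos.ne',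
      Real.log_mul hC.ne' (Real.exp_pos _).ne', Real.log_exp] at this
    rw [Real.log_div hC.ne' hη.ne']
    linarith

theorem isLittleO_sqrt_of_bounds {x : ℕ → ℝ} {c q : ℝ}
    (h : ∀ δ > 0, ∃ K, ∀ᶠ n : ℕ in atTop,
      n * c + √n * (q - δ) ≤ x n ∧ x n ≤ n * c + √n * (q + δ) + K) :
    (fun n : ℕ => x n - (n * c + √n * q)) =o[atTop] fun n : ℕ => √(n : ℝ) := by
  refine isLittleO_iff.2 fun d hd => ?_
  obtain ⟨K, hK⟩ := h (d / 2) (half_pos hd)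
  have hlarge : ∀ᶠ n : ℕ in atTop, K ≤ d / 2 * √(n : ℝ) :=
    ((Real.tendsto_sqrt_atTop.comp tendsto_natCast_atTop_atTop).const_mul_atTop
      (half_pos hd)).eventually_ge_atTop K
  filter_upwards [hK, hlarge] with n h1 h2
  rw [Real.norm_eq_abs, Real.norm_of_nonneg (Real.sqrt_nonneg _), abs_le]
  have := mul_nonneg hd.le (Real.sqrt_nonneg (n : ℝ))
  constructor <;> nlinarith

/-! ### The likelihood ratio of two Markov chains -/

theorem eq_mul_exp_logRatioGenerator {X : Type*} {W₀ W₁ : Matrix X X ℝ} (h0 : ∀ x y, 0 ≤ W₀ x y)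
    (h1 : ∀ x y, 0 ≤ W₁ x y) (hsupp : ∀ x y, W₀ x y = 0 ↔ W₁ x y = 0) (x y : X) :
    W₁ x y = W₀ x y * Real.exp (logRatioGenerator W₁ W₀ x y) := by
  by_cases h : W₀ x y = 0
  · simp [h, (hsupp x y).1 h]
  · have h2 : 0 < W₀ x y := (h0 x y).lt_of_ne' h
    have h3 : 0 < W₁ x y := (h1 x y).lt_of_ne' fun h4 => h ((hsupp x y).2 h4)
    rw [logRatioGenerator, Real.exp_log (div_pos h3 h2), mul_div_cancel₀ _ h2.ne']

theorem relativePotential_eq_markovPotential {X : Type*} [Fintype X] [DecidableEq X]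
    {W₀ W₁ : Matrix X X ℝ} (h0 : ∀ x y, 0 ≤ W₀ x y) (h1 : ∀ x y, 0 ≤ W₁ x y)
    (hsupp : ∀ x y, W₀ x y = 0 ↔ W₁ x y = 0) :
    relativePotential W₁ W₀ = markovPotential W₀ (logRatioGenerator W₁ W₀) := by
  ext t
  unfold relativePotential markovPotential
  congr 3
  ext x y
  by_cases h : W₀ x y = 0
  · -- At least one of the exponents `t` and `1 - t` is non-zero.
    rw [(hsupp x y).1 h, h]
    rcases eq_or_ne t 0 with rfl | ht
    · simp
    · simp [Real.zero_rpow ht]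
  · have h2 : 0 < W₀ x y := (h0 x y).lt_of_ne' h
    have h3 : 0 < W₁ x y := (h1 x y).lt_of_ne' fun h4 => h ((hsupp x y).2 h4)
    rw [logRatioGenerator, Real.rpow_sub h2, Real.rpow_one, mul_comm t, ← Real.rpow_def_of_pos
      (div_pos h3 h2), Real.div_rpow h3.le h2.le]
    ring

/-- Tilting by the full likelihood ratio turns `W₀` into `W₁`, which moves the origin of the
potential to `1`. -/
theorem markovPotential_logRatioGenerator {X : Type*} [Fintype X] [DecidableEq X]
    {W₀ W₁ : Matrix X X ℝ} (h0 : ∀ x y, 0 ≤ W₀ x y) (h1 : ∀ x y, 0 ≤ W₁ x y)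
    (hsupp : ∀ x y, W₀ x y = 0 ↔ W₁ x y = 0) :
    markovPotential W₀ (logRatioGenerator W₁ W₀)
      = fun t => markovPotential W₁ (logRatioGenerator W₁ W₀) (t - 1) := by
  ext t
  unfold markovPotential
  congr 3
  ext x y
  rw [eq_mul_exp_logRatioGenerator h0 h1 hsupp x y, mul_assoc, ← Real.exp_add]
  congr 2
  ring

theorem markovPathLaw_eq_mul_exp {X : Type*} {W₀ W₁ : Matrix X X ℝ} {g : X → X → ℝ}
    (hg : ∀ x y, W₁ x y = W₀ x y * Real.exp (g x y)) (P : X → ℝ) (n : ℕ) (w : Fin (n + 1) → X) :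
    markovPathLaw W₁ P n w = markovPathLaw W₀ P n w * Real.exp (pathSum g n w) := by
  simp only [markovPathLaw, pathSum, hg, Finset.prod_mul_distrib, Real.exp_sum, mul_assoc]

theorem exists_forall_le_mul_of_mem_stdSimplex {X : Type*} [Fintype X] {P₀ P₁ : X → ℝ}
    (hP₀ : P₀ ∈ stdSimplex ℝ X) (hP₁ : P₁ ∈ stdSimplex ℝ X) (hP : ∀ x, P₀ x = 0 → P₁ x = 0) :
    ∃ C > 0, ∀ x, P₁ x ≤ C * P₀ x := by
  have hnn : ∀ x ∈ Finset.univ, 0 ≤ P₁ x / P₀ x := fun x _ => div_nonneg (hP₁.1 x) (hP₀.1 x)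
  refine ⟨1 + ∑ x, P₁ x / P₀ x, by linarith [Finset.sum_nonneg hnn], fun x => ?_⟩
  by_cases h : P₀ x = 0
  · simp [h, hP x h]
  · calc P₁ x = P₁ x / P₀ x * P₀ x := (div_mul_cancel₀ _ h).symm
      _ ≤ _ := mul_le_mul_of_nonneg_right
        (by linarith [Finset.single_le_sum hnn (Finset.mem_univ x)]) (hP₀.1 x)

/-! ### The second-order expansion of the error exponents -/

theorem mainTheorem7 {X : Type*} [Fintype X] [DecidableEq X]
    (W₀ W₁ : Matrix X X ℝ)
    (hW₀ : IsTransitionMatrix W₀) (hW₁ : IsTransitionMatrix W₁)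
    (hE₀ : IsErgodicMatrix W₀) (hE₁ : IsErgodicMatrix W₁)
    (hsupp : ∀ x y, W₀ x y = 0 ↔ W₁ x y = 0)
    (P₀ P₁ : X → ℝ) (hP₀ : P₀ ∈ stdSimplex ℝ X) (hP₁ : P₁ ∈ stdSimplex ℝ X)
    (hP : ∀ x, P₀ x = 0 → P₁ x = 0)
    (ε : ℝ) (hε₀ : 0 < ε) (hε₁ : ε < 1) :
    DifferentiableAt ℝ (relativePotential W₁ W₀) 1 ∧
    ContDiffAt ℝ 2 (markovPotential W₀ (logRatioGenerator W₁ W₀)) 1 ∧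
    0 ≤ iteratedDeriv 2 (markovPotential W₀ (logRatioGenerator W₁ W₀)) 1 ∧
    (fun n : ℕ =>
        -Real.log (betaError ε (markovPathLaw W₁ P₁ n) (markovPathLaw W₀ P₀ n))
          - (n * markovRelativeEntropy W₁ W₀
            + √n * √(iteratedDeriv 2 (markovPotential W₀ (logRatioGenerator W₁ W₀)) 1)
              * gaussianQuantile ε))
      =o[atTop] (fun n : ℕ => √(n : ℝ)) ∧
    (fun n : ℕ =>
        -Real.log (betaErrorDet ε (markovPathLaw W₁ P₁ n) (markovPathLaw W₀ P₀ n))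
          - (n * markovRelativeEntropy W₁ W₀
            + √n * √(iteratedDeriv 2 (markovPotential W₀ (logRatioGenerator W₁ W₀)) 1)
              * gaussianQuantile ε))
      =o[atTop] (fun n : ℕ => √(n : ℝ)) := by
  set g := logRatioGenerator W₁ W₀ with hg
  have hratio := eq_mul_exp_logRatioGenerator hW₀.1 hW₁.1 hsupp
  have hshift := markovPotential_logRatioGenerator hW₀.1 hW₁.1 hsupp
  obtain ⟨hsmooth, hV, hclt⟩ := markovPotential_contDiffAt_and_clt hW₁ hE₁.1 hP₁ g
  have hrel := relativePotential_eq_markovPotential hW₀.1 hW₁.1 hsupp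
  rw [← hg] at hratio hshift hrel
  have hcont : ContDiffAt ℝ 2 (markovPotential W₀ g) 1 := by
    rw [hshift]
    have h1 : ContDiffAt ℝ 2 (markovPotential W₁ g) ((1 : ℝ) - 1) := by rwa [sub_self]
    exact ContDiffAt.comp (f := fun t : ℝ => t - 1) 1 h1 (contDiffAt_id.sub contDiffAt_const)
  have hV' : iteratedDeriv 2 (markovPotential W₀ g) 1
      = iteratedDeriv 2 (markovPotential W₁ g) 0 := by
    rw [hshift, iteratedDeriv_comp_sub_const]
    simp
  have hD : markovRelativeEntropy W₁ W₀ = deriv (markovPotential W₁ g) 0 := by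
    rw [markovRelativeEntropy, hrel, hshift, deriv_comp_sub_const, sub_self]
  rw [hV', hD]
  set V := iteratedDeriv 2 (markovPotential W₁ g) 0
  set D := deriv (markovPotential W₁ g) 0
  obtain ⟨C, hC, hPC⟩ := exists_forall_le_mul_of_mem_stdSimplex hP₀ hP₁ hP
  have hexp : ∀ n, ∑ w, markovPathLaw W₀ P₀ n w * Real.exp (pathSum g n w) = 1 := fun n => by
    simpa only [← markovPathLaw_eq_mul_exp hratio] using sum_markovPathLaw hW₁ hP₀ n
  have hr : ∀ n w, markovPathLaw W₁ P₁ n w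
      ≤ C * Real.exp (pathSum g n w) * markovPathLaw W₀ P₀ n w := fun n w => by
    rw [mul_assoc, mul_comm (Real.exp _), ← markovPathLaw_eq_mul_exp hratio, markovPathLaw,
      markovPathLaw, ← mul_assoc]
    exact mul_le_mul_of_nonneg_right (hPC _) (Finset.prod_nonneg fun _ _ => hW₁.1 _ _)
  have hbounds : ∀ δ > 0, ∃ K, ∀ᶠ n : ℕ in atTop,
      n * D + √n * (√V * gaussianQuantile ε - δ)
        ≤ -Real.log (betaErrorDet ε (markovPathLaw W₁ P₁ n) (markovPathLaw W₀ P₀ n)) ∧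
      -Real.log (betaErrorDet ε (markovPathLaw W₁ P₁ n) (markovPathLaw W₀ P₀ n))
        ≤ -Real.log (betaError ε (markovPathLaw W₁ P₁ n) (markovPathLaw W₀ P₀ n)) ∧
      -Real.log (betaError ε (markovPathLaw W₁ P₁ n) (markovPathLaw W₀ P₀ n))
        ≤ n * D + √n * (√V * gaussianQuantile ε + δ) + K := by
    intro δ hδ
    obtain ⟨h1, h2, h3, h4⟩ := cdf_gaussianReal_quantile hε₀ hε₁ V.toNNReal hδ
    rw [Real.coe_toNNReal V hV] at h1 h2 h3 h4
    -- Half of the gap above `ε` in the limit survives for all large `n`.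
    obtain ⟨η, hη₀, hη⟩ : ∃ η > 0, ε + η
        < cdf (gaussianReal 0 V.toNNReal) (√V * gaussianQuantile ε + δ) :=
      ⟨(cdf (gaussianReal 0 V.toNNReal) (√V * gaussianQuantile ε + δ) - ε) / 2,
        by linarith, by linarith⟩
    refine ⟨Real.log (C / η), ?_⟩
    filter_upwards [(hclt _ h3).eventually (gt_mem_nhds h1),
      (hclt _ h4).eventually (lt_mem_nhds hη)] with n h5 h6
    exact neg_log_betaError_bounds hε₀.le hC hη₀ (markovPathLaw_nonneg hW₀ hP₀ n)
      (markovPathLaw_nonneg hW₁ hP₁ n) (sum_markovPathLaw hW₀ hP₀ n) (hexp n) (hr n) h5.le h6.le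
  refine ⟨?_, hcont, hV, ?_, ?_⟩
  · rw [hrel]
    exact hcont.differentiableAt (by norm_num)
  · simp only [mul_assoc]
    refine isLittleO_sqrt_of_bounds fun δ hδ => (hbounds δ hδ).imp fun K hK => ?_
    filter_upwards [hK] with n hn using ⟨hn.1.trans hn.2.1, hn.2.2⟩
  · simp only [mul_assoc]
    refine isLittleO_sqrt_of_bounds fun δ hδ => (hbounds δ hδ).imp fun K hK => ?_
    filter_upwards [hK] with n hn using ⟨hn.1, hn.2.1.trans hn.2.2⟩
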